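/- Let $\theta\in(0,\frac{\pi}{4})$, $s=\sin\theta\cos\theta$, $t=\sin^2\theta$, and let $\mathcal R=[0,1]^2$ be the unit square with centre $Z=(\frac12,\frac12)$ and vertices $E_1=(0,0)$, $E_2=(1,0)$, $E_3=(1,1)$, $E_4=(0,1)$. Put $$P_1=(s,t),\quad P_2=(1-t,s),\quad P_3=(1-s,1-t),\quad P_4=(t,1-s),$$ $$P_1'=(1-s,t),\quad P_2'=(1-t,1-s),\quad P_3'=(s,1-t),\quad P_4'=(t,s).$$ With indices $i\in\{1,2,3,4\}$ taken cyclically, $\mathcal R$ is divided into the closed triangles $\mathcal A_i=\Delta(E_i,E_{i+1},P_i)$ and $\mathcal B_i=\Delta(E_i,P_i,P_{i-1})$ and the closed centre square $\mathcal C$ with vertices $P_1,P_2,P_3,P_4$. Let $F=F_\theta\colon\mathcal R\to\mathcal R$ be the map with $F(E_i)=E_i$ and $F(P_i)=P_i'$ for all $i$ which is affine on each of these nine pieces. Let $R$ be the rotation about $Z$ by the angle $\frac{\pi}{2}$. A rotationally symmetric invariant circle is a simple closed curve $\Gamma\subset\mathcal R$ with $F(\Gamma)=\Gamma$ which encircles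 $Z$ (that is, $Z\notin\Gamma$ and $Z$ lies in the bounded component of the complement of $\Gamma$), on which $F$ preserves the $S^1$-order of points, and with $R(\Gamma)=\Gamma$. **Proposition.** Let $\Gamma$ be a rotationally symmetric invariant circle disjoint from $\mathcal C$. For each $i$ let $U_i$ denote the intersection points of $\Gamma$ with the break segment $\mathcal B_i\cap\mathcal A_i=\overline{E_iP_i}$, and $V_i$ those with the break segment $\mathcal A_i\cap\mathcal B_{i+1}=\overline{E_{i+1}P_i}$. Then $F|_\Gamma$ is periodic (that is, there is $q\ge 1$ with $F^q(x)=x$ for all $x\in\Gamma$) if and only if, for every $i$, the $F$-orbits of $U_i$ and $V_i$ are periodic. -/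

import Mathlib

namespace SquareMap

/-! The parameter is an angle `θ ∈ (0, π/4)`. The cyclic index set is `Fin 4` with its
wrap-around addition: the vertices, pieces and break points usually numbered `1, 2, 3, 4` are
numbered `0, 1, 2, 3` here. -/

/-- The unit square `[0,1] × [0,1]`. -/
def rect : Set (ℝ × ℝ) := Set.Icc 0 1 ×ˢ Set.Icc 0 1

/-- The centre `Z` of the unit square. -/
noncomputable def Z : ℝ × ℝ := (1 / 2, 1 / 2)

/-- The counterclockwise rotation about `Z` by the angle `π/2`. -/
def rot (p : ℝ × ℝ) : ℝ × ℝ := (1 - p.2, p.1)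

/-- The clockwise rotation about `Z` by the angle `π/2`, the inverse of `rot`. -/
def rotInv (p : ℝ × ℝ) : ℝ × ℝ := (p.2, 1 - p.1)

/-- The abscissa of the first vertex of the inner square. -/
noncomputable def s (θ : ℝ) : ℝ := Real.sin θ * Real.cos θ

/-- The ordinate of the first vertex of the inner square. -/
noncomputable def t (θ : ℝ) : ℝ := Real.sin θ ^ 2

theorem st_rel (θ : ℝ) : s θ ^ 2 = t θ - t θ ^ 2 := by
  simp only [s, t, mul_pow, Real.cos_sq']; ring

theorem t_pos {θ : ℝ} (hθ : θ ∈ Set.Ioo 0 (Real.pi / 4)) : 0 < t θ :=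
  pow_pos (Real.sin_pos_of_pos_of_lt_pi hθ.1 (by linarith [hθ.2, Real.pi_pos])) 2

theorem t_lt_s {θ : ℝ} (hθ : θ ∈ Set.Ioo 0 (Real.pi / 4)) : t θ < s θ := by
  have hs := Real.sin_pos_of_pos_of_lt_pi hθ.1 (by linarith [hθ.2, Real.pi_pos])
  have hc : Real.sin θ < Real.cos θ := by
    rw [← Real.sin_pi_div_two_sub]
    exact Real.sin_lt_sin_of_lt_of_le_pi_div_two (by linarith [hθ.1, Real.pi_pos])
      (by linarith [hθ.1]) (by linarith [hθ.2])
  unfold s t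
  nlinarith

/-- The vertices of the unit square, counterclockwise from the origin. -/
def E : Fin 4 → ℝ × ℝ := ![(0, 0), (1, 0), (1, 1), (0, 1)]

/-- The ray starting at the vertex `E i` and making the (counterclockwise) angle `θ` with the
side from `E i` to `E (i + 1)`. -/
noncomputable def ray (θ : ℝ) (i : Fin 4) : Set (ℝ × ℝ) :=
  {p | ∃ r : ℝ, 0 ≤ r ∧
    p = E i + r • (Real.cos θ • (E (i + 1) - E i) + Real.sin θ • (E (i - 1) - E i))}

/-- The vertices of the inner square: `P θ i` is the intersection point of the rays
`ray θ (i - 1)` and `ray θ i`, in coordinates. -/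
noncomputable def P (θ : ℝ) : Fin 4 → ℝ × ℝ :=
  ![(s θ, t θ), (1 - t θ, s θ), (1 - s θ, 1 - t θ), (t θ, 1 - s θ)]

theorem P_mem_ray {θ : ℝ} (hθ : θ ∈ Set.Ioo 0 (Real.pi / 4)) (i : Fin 4) : P θ i ∈ ray θ (i - 1) ∩ ray θ i := by
  have hs := Real.sin_pos_of_pos_of_lt_pi hθ.1 (by linarith [hθ.2, Real.pi_pos])
  have hc : 0 < Real.cos θ := Real.cos_pos_of_mem_Ioo ⟨by linarith [hθ.1, Real.pi_pos], by linarith [hθ.2, Real.pi_pos]⟩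
  have h := Real.sin_sq_add_cos_sq θ
  refine ⟨⟨Real.cos θ, hc.le, ?_⟩, ⟨Real.sin θ, hs.le, ?_⟩⟩ <;>
  fin_cases i <;> ext <;> simp [E, P, s, t, show (-1 - 1 : Fin 4) = 2 from rfl] <;> linarith

/-- The vertices of the inner square of the construction in reverse orientation (the mirror image
of the first one under `(x, y) ↦ (1 - x, y)`), counterclockwise, starting with the vertex that has
the same ordinate as `P θ 0`. -/
noncomputable def P' (θ : ℝ) : Fin 4 → ℝ × ℝ :=
  ![(1 - s θ, t θ), (1 - t θ, 1 - s θ), (s θ, 1 - t θ), (t θ, s θ)]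

/-- The triangle with vertices `E i`, `E (i + 1)`, `P i`, adjacent to a side of the square. -/
noncomputable def pieceA (θ : ℝ) (i : Fin 4) : Set (ℝ × ℝ) :=
  convexHull ℝ {E i, E (i + 1), P θ i}

/-- The triangle with vertices `E i`, `P i`, `P (i - 1)`. -/
noncomputable def pieceB (θ : ℝ) (i : Fin 4) : Set (ℝ × ℝ) :=
  convexHull ℝ {E i, P θ i, P θ (i - 1)}

/-- The (closed) centre square. -/
noncomputable def pieceC (θ : ℝ) : Set (ℝ × ℝ) :=
  convexHull ℝ {P θ 0, P θ 1, P θ 2, P θ 3}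

/-- The shear fixing `E 0`, `E 1` and mapping `P 0` to `P' 0`. -/
noncomputable def shear (θ : ℝ) (p : ℝ × ℝ) : ℝ × ℝ :=
  (p.1 + (1 - 2 * s θ) / t θ * p.2, p.2)

/-- The linear map fixing `E 0` and mapping `P 0` to `P' 0` and `P 3` to `P' 3`. -/
noncomputable def scaling (θ : ℝ) (p : ℝ × ℝ) : ℝ × ℝ :=
  (((t θ ^ 2 - (1 - s θ) ^ 2) * p.1 + (1 - 2 * s θ) * t θ * p.2) / (t θ - s θ),
    ((2 * s θ - 1) * t θ * p.1 + (2 * t θ - 1) * t θ * p.2) / (t θ - s θ))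

/-- The affine map on `pieceA θ i`, which is `pieceA θ 0` rotated by `i` quarter turns. -/
noncomputable def mapA (θ : ℝ) (i : Fin 4) (p : ℝ × ℝ) : ℝ × ℝ :=
  rot^[(i : ℕ)] (shear θ (rotInv^[(i : ℕ)] p))

/-- The affine map on `pieceB θ i`, which is `pieceB θ 0` rotated by `i` quarter turns. -/
noncomputable def mapB (θ : ℝ) (i : Fin 4) (p : ℝ × ℝ) : ℝ × ℝ :=
  rot^[(i : ℕ)] (scaling θ (rotInv^[(i : ℕ)] p))

/-- The affine map on `pieceC θ`, the rotation about `Z` mapping each `P i` to `P' i`. -/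
noncomputable def mapC (θ : ℝ) (p : ℝ × ℝ) : ℝ × ℝ :=
  (2 * s θ * p.1 + (2 * t θ - 1) * p.2 + (1 - t θ - s θ),
    (1 - 2 * t θ) * p.1 + 2 * s θ * p.2 + (t θ - s θ))

theorem mapA_vertices {θ : ℝ} (hθ : θ ∈ Set.Ioo 0 (Real.pi / 4)) (i : Fin 4) :
    mapA θ i (E i) = E i ∧ mapA θ i (E (i + 1)) = E (i + 1) ∧ mapA θ i (P θ i) = P' θ i := by
  have ht := (t_pos hθ).ne'
  fin_cases i <;> simp [mapA, shear, rot, rotInv, E, P, P', ht] <;> ring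

theorem mapB_vertices {θ : ℝ} (hθ : θ ∈ Set.Ioo 0 (Real.pi / 4)) (i : Fin 4) :
    mapB θ i (E i) = E i ∧ mapB θ i (P θ i) = P' θ i ∧
      mapB θ i (P θ (i - 1)) = P' θ (i - 1) := by
  have hst : t θ - s θ ≠ 0 := (sub_neg.2 (t_lt_s hθ)).ne
  have h := st_rel θ
  have h1 : scaling θ (s θ, t θ) = (1 - s θ, t θ) := by
    ext <;> simp only [scaling] <;> rw [div_eq_iff hst]
    · linear_combination (1 - s θ) * h
    · linear_combination (2 * t θ) * h
  have h2 : scaling θ (t θ, 1 - s θ) = (t θ, s θ) := by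
    ext <;> simp only [scaling] <;> rw [div_eq_iff hst]
    · linear_combination (t θ) * h
    · linear_combination h
  have h0 : scaling θ (0, 0) = (0, 0) := by simp [scaling]
  fin_cases i <;> simp [mapB, rot, rotInv, E, P, P', h0, h1, h2]

theorem mapC_vertices (θ : ℝ) (i : Fin 4) : mapC θ (P θ i) = P' θ i := by
  have h := st_rel θ
  fin_cases i <;> ext <;> simp [mapC, P, P'] <;> linarith

open Classical in
/-- The piecewise affine map `F = F_θ` of the unit square: the continuous map which fixes the
`E i`, maps each `P i` to `P' i`, and is affine on each of the nine pieces. Affine maps of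
adjacent pieces agree at the end points of the common edge (see the three facts above), hence on
that edge, so the order of the cases is immaterial. Outside the unit square the value is
irrelevant; there it is set to the identity. -/
noncomputable def F (θ : ℝ) (p : ℝ × ℝ) : ℝ × ℝ :=
  if p ∈ pieceA θ 0 then mapA θ 0 p
  else if p ∈ pieceA θ 1 then mapA θ 1 p
  else if p ∈ pieceA θ 2 then mapA θ 2 p
  else if p ∈ pieceA θ 3 then mapA θ 3 p
  else if p ∈ pieceB θ 0 then mapB θ 0 p
  else if p ∈ pieceB θ 1 then mapB θ 1 p
  else if p ∈ pieceB θ 2 then mapB θ 2 p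
  else if p ∈ pieceB θ 3 then mapB θ 3 p
  else if p ∈ pieceC θ then mapC θ p
  else p

/-- `Γ` is a rotationally symmetric invariant circle of `F θ`: a simple closed curve in the unit
square, invariant under `F θ`, encircling `Z`, on which `F θ` preserves the cyclic order of
points, and which is mapped to itself by the quarter turn about `Z`. -/
structure IsRotSymmInvariantCircle (θ : ℝ) (Γ : Set (ℝ × ℝ)) : Prop where
  subset_rect : Γ ⊆ rect
  invariant : F θ '' Γ = Γ
  /-- `Z` lies in a bounded component of the complement of `Γ`. -/
  encircles : Z ∉ Γ ∧ Bornology.IsBounded (connectedComponentIn Γᶜ Z)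
  /-- `Γ` has an injective continuous parametrization `γ` by the circle `ℝ/ℤ`, in which `F θ`
  lifts to a monotone map `g : ℝ → ℝ` with `g (x + 1) = g x + 1`; that is, `Γ` is a simple closed
  curve and `F θ` preserves the cyclic order on it. -/
  circle : ∃ γ : UnitAddCircle → ℝ × ℝ, Continuous γ ∧ Function.Injective γ ∧ Set.range γ = Γ ∧
    ∃ g : CircleDeg1Lift, ∀ x : ℝ, F θ (γ (x : UnitAddCircle)) = γ ((g x : ℝ) : UnitAddCircle)
  rot_symm : rot '' Γ = Γ

/-- The intersection of `Γ` with the break segment between `pieceB θ i` and `pieceA θ i`,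
consisting of the break point `U i`. -/
def breakU (θ : ℝ) (Γ : Set (ℝ × ℝ)) (i : Fin 4) : Set (ℝ × ℝ) :=
  Γ ∩ (pieceB θ i ∩ pieceA θ i)

/-- The intersection of `Γ` with the break segment between `pieceA θ i` and `pieceB θ (i + 1)`,
consisting of the break point `V i`. -/
def breakV (θ : ℝ) (Γ : Set (ℝ × ℝ)) (i : Fin 4) : Set (ℝ × ℝ) :=
  Γ ∩ (pieceA θ i ∩ pieceB θ (i + 1))

/-- The restriction of `f` to the invariant set `Γ` is periodic: some positive iterate of it is
the identity of `Γ`. -/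
def IsPeriodicOn (f : ℝ × ℝ → ℝ × ℝ) (Γ : Set (ℝ × ℝ)) : Prop :=
  ∃ q : ℕ, 0 < q ∧ ∀ p ∈ Γ, f^[q] p = p

end SquareMap

/-!
Lift `F|Γ` to a monotone map `g` of the real line. All periodic points on `Γ` have the same
translation number, so a period of one of them is a period `n` of all of them, the break points
included. An arc between two neighbouring fixed points of `F^n` then contains no point whose orbit
meets a break segment, so `F^n` is affine on it, of determinant `1` and with two fixed points,
hence a shear; since its orbits on the arc are bounded, it is the identity there. This needs at
least two break points: as `Γ` encircles the centre square, it crosses every segment from a vertex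
`P i` of that square to the corner `E i`.
-/

namespace SquareMap

open Bornology Function Module Set
open scoped Pointwise

section SpecialAffine

theorem map_sub_self_of_det_eq_one {K V : Type*} [Field K] [AddCommGroup V] [Module K V]
    (hV : finrank K V = 2) {L : V →ₗ[K] V} (hL : LinearMap.det L = 1) {v : V} (hv : v ≠ 0)
    (hLv : L v = v) (w : V) : L (L w - w) = L w - w := by
  have : FiniteDimensional K V := .of_finrank_pos (by lia)
  set W : Submodule K V := K ∙ v
  have fixed : ∀ x ∈ W, L x = x := by
    intro x hx
    obtain ⟨c, rfl⟩ := Submodule.mem_span_singleton.1 hx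
    rw [map_smul, hLv]
  have hW : W ≤ W.comap L := fun x hx => by rwa [Submodule.mem_comap, fixed x hx]
  have hquot : finrank K (V ⧸ W) = 1 := by
    have := W.finrank_quotient_add_finrank
    rw [finrank_span_singleton hv] at this
    lia
  have hres : L.restrict hW = LinearMap.id := LinearMap.ext fun x => Subtype.ext (fixed x x.2)
  have hdet : LinearMap.det (W.mapQ W L hW) = 1 := by
    have := L.det_eq_det_mul_det W hW
    rwa [hL, hres, LinearMap.det_id, one_mul, eq_comm] at this
  have hmapQ : W.mapQ W L hW = LinearMap.id := by
    obtain ⟨c, hc, -⟩ := (W.mapQ W L hW).existsUnique_eq_smul_id_of_finrank_eq_one hquot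
    rw [hc, LinearMap.det_smul, hquot, pow_one, LinearMap.det_id, mul_one] at hdet
    rw [hc, hdet, one_smul]
  refine fixed _ ((Submodule.Quotient.eq W).1 ?_)
  rw [← W.mapQ_apply W L (h := hW), hmapQ, LinearMap.id_apply]

/-- Orientation and volume preserving affine self-maps of a real vector space: the linear part has
determinant `1`. This is a predicate on plain functions because the pieces of `F θ` are such. -/
def IsSpecialAffine {V : Type*} [AddCommGroup V] [Module ℝ V] (f : V → V) : Prop :=
  ∃ A : V →ᵃ[ℝ] V, LinearMap.det A.linear = 1 ∧ ⇑A = f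

namespace IsSpecialAffine

variable {V : Type*} [AddCommGroup V] [Module ℝ V] {f g : V → V}

protected theorem id : IsSpecialAffine (id : V → V) :=
  ⟨AffineMap.id ℝ V, LinearMap.det_id, rfl⟩

theorem comp (hf : IsSpecialAffine f) (hg : IsSpecialAffine g) : IsSpecialAffine (f ∘ g) := by
  obtain ⟨A, hA, rfl⟩ := hf
  obtain ⟨B, hB, rfl⟩ := hg
  exact ⟨A.comp B, by rw [AffineMap.comp_linear, LinearMap.det_comp, hA, hB, one_mul], rfl⟩

theorem iterate (hf : IsSpecialAffine f) : ∀ n : ℕ, IsSpecialAffine f^[n]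
  | 0 => .id
  | n + 1 => (hf.iterate n).comp hf

theorem injective [FiniteDimensional ℝ V] (hf : IsSpecialAffine f) : Injective f := by
  obtain ⟨A, hA, rfl⟩ := hf
  rw [← AffineMap.linear_injective_iff, ← LinearMap.ker_eq_bot]
  by_contra h
  exact one_ne_zero (hA.symm.trans (LinearMap.det_eq_zero_iff_ker_ne_bot.2 h))

theorem iterate_eq_add_nsmul (hV : finrank ℝ V = 2) (hf : IsSpecialAffine f) {p q : V}
    (hp : f p = p) (hq : f q = q) (hpq : p ≠ q) (x : V) (n : ℕ) :
    f^[n] x = x + n • (f x - x) := by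
  obtain ⟨A, hA, rfl⟩ := hf
  have sub (y z : V) : A.linear (y - z) = A y - A z := A.linearMap_vsub y z
  have hfix : A.linear (A x - x) = A x - x := by
    have hdispl : A.linear (x - p) - (x - p) = A x - x := by rw [sub, hp, sub_sub_sub_cancel_right]
    rw [← hdispl]
    exact map_sub_self_of_det_eq_one hV hA (sub_ne_zero.2 hpq) (by rw [sub, hp, hq]) (x - p)
  induction n with
  | zero => simp
  | succ n ih =>
    rw [iterate_succ_apply', ih, add_comm x, ← vadd_eq_add, A.map_vadd, map_nsmul, hfix,
      vadd_eq_add, succ_nsmul]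
    abel

theorem image_convexHull (hf : IsSpecialAffine f) (S : Set V) :
    f '' convexHull ℝ S = convexHull ℝ (f '' S) := by
  obtain ⟨A, -, rfl⟩ := hf
  exact A.image_convexHull S

end IsSpecialAffine

theorem isSpecialAffine_of_coordinates {f : ℝ × ℝ → ℝ × ℝ} (a b c d e k : ℝ)
    (hdet : a * d - b * c = 1) (hf : ∀ p, f p = (a * p.1 + b * p.2 + e, c * p.1 + d * p.2 + k)) :
    IsSpecialAffine f := by
  let L := Matrix.toLin (Basis.finTwoProd ℝ) (Basis.finTwoProd ℝ) !![a, b; c, d]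
  refine ⟨L.toAffineMap + AffineMap.const ℝ _ (e, k), ?_, funext fun p => ?_⟩
  · rw [AffineMap.add_linear, AffineMap.const_linear, add_zero]
    exact (LinearMap.det_toLin _ _).trans ((Matrix.det_fin_two_of a b c d).trans hdet)
  · rw [hf]
    exact congrArg (· + (e, k)) (Matrix.toLin_finTwoProd_apply a b c d p)

section Normed

variable {V : Type*} [NormedAddCommGroup V] [NormedSpace ℝ V] {f : V → V}

theorem IsSpecialAffine.continuous [FiniteDimensional ℝ V] (hf : IsSpecialAffine f) :
    Continuous f := by
  obtain ⟨A, -, rfl⟩ := hf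
  exact A.continuous_of_finiteDimensional

theorem eq_zero_of_isBounded_range_nsmul {v : V} (hv : IsBounded (range fun n : ℕ => n • v)) :
    v = 0 := by
  obtain ⟨C, hC⟩ := hv.exists_norm_le
  by_contra hne
  obtain ⟨n, hn⟩ := Archimedean.arch (C + 1) (norm_pos_iff.2 hne)
  have := hC _ (mem_range_self n)
  rw [RCLike.norm_nsmul ℝ] at this
  linarith

/-- Two fixed points make `f` a shear, whose orbits off the line of fixed points are unbounded. -/
theorem IsSpecialAffine.eqOn_id_of_mapsTo (hV : finrank ℝ V = 2) (hf : IsSpecialAffine f) {p q : V}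
    (hp : f p = p) (hq : f q = q) (hpq : p ≠ q) {K : Set V} (hK : IsBounded K)
    (hfK : MapsTo f K K) : EqOn f id K := by
  intro x hx
  have hKx : IsBounded (K - {x}) := hK.sub isBounded_singleton
  refine sub_eq_zero.1 (eq_zero_of_isBounded_range_nsmul (hKx.subset ?_))
  rintro _ ⟨n, rfl⟩
  refine ⟨f^[n] x, hfK.iterate n hx, x, rfl, ?_⟩
  simp only [hf.iterate_eq_add_nsmul hV hp hq hpq, id, add_sub_cancel_left]

end Normed

end SpecialAffine

section CurveLift

theorem injective_of_monotone_of_finite_fibers {α β : Type*} [LinearOrder α] [DenselyOrdered α]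
    [PartialOrder β] {g : α → β} (hg : Monotone g) (hfib : ∀ c, (g ⁻¹' {c}).Finite) :
    Injective g := by
  refine .of_lt_imp_ne fun x y hxy hgxy => Icc_infinite hxy ((hfib (g x)).subset ?_)
  exact fun z hz => le_antisymm ((hg hz.2).trans hgxy.ge) (hg hz.1)

theorem circleDeg1Lift_pow_eq_add_int {g : CircleDeg1Lift} {u v : ℝ} {n n' : ℕ} {m m' : ℤ}
    (hn : 0 < n) (hn' : 0 < n') (hu : (g ^ n) u = u + m) (hv : (g ^ n') v = v + m') :
    (g ^ n) v = v + m := by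
  have h1 := g.translationNumber_of_map_pow_eq_add_int hu hn
  have h2 := g.translationNumber_of_map_pow_eq_add_int hv hn'
  rw [h1, div_eq_div_iff (by positivity) (by positivity)] at h2
  rw [← (g ^ n).iterate_pos_eq_iff hn', ← CircleDeg1Lift.coe_pow, ← pow_mul, mul_comm, pow_mul,
    CircleDeg1Lift.coe_pow, (g ^ n').iterate_eq_of_map_eq_add_int hv n]
  linarith

theorem unitAddCircle_coe_eq_coe_iff {x y : ℝ} :
    (x : UnitAddCircle) = y ↔ ∃ m : ℤ, x = y + m := by
  rw [← sub_eq_zero, ← AddCircle.coe_sub, AddCircle.coe_eq_zero_iff]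
  simp only [zsmul_eq_mul, mul_one, sub_eq_iff_eq_add', @eq_comm _ _ (x - y)]

/-- `φ` is a `1`-periodic parametrization of a simple closed curve, `range φ`, on which `f` acts as
the circle map with lift `g`. -/
structure IsCurveLift {X : Type*} [TopologicalSpace X] (f : X → X) (φ : ℝ → X)
    (g : CircleDeg1Lift) : Prop where
  continuous : Continuous φ
  eq_iff : ∀ {x y}, φ x = φ y ↔ ∃ m : ℤ, x = y + m
  semiconj : Semiconj φ g f

namespace IsCurveLift

variable {X : Type*} [TopologicalSpace X] {f : X → X} {φ : ℝ → X} {g : CircleDeg1Lift}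

theorem of_unitAddCircle {γ : UnitAddCircle → X} (hγ : Continuous γ) (hinj : Injective γ)
    (hg : ∀ x : ℝ, f (γ x) = γ (g x : ℝ)) : IsCurveLift f (fun x => γ x) g where
  continuous := hγ.comp (AddCircle.continuous_mk' 1)
  eq_iff := hinj.eq_iff.trans unitAddCircle_coe_eq_coe_iff
  semiconj x := (hg x).symm

theorem map_pow (h : IsCurveLift f φ g) (n : ℕ) (x : ℝ) : φ ((g ^ n) x) = f^[n] (φ x) := by
  rw [CircleDeg1Lift.coe_pow, (h.semiconj.iterate_right n).eq]

theorem iterate_eq_self_iff (h : IsCurveLift f φ g) {n : ℕ} {x : ℝ} :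
    f^[n] (φ x) = φ x ↔ ∃ m : ℤ, (g ^ n) x = x + m := by
  rw [← h.map_pow, h.eq_iff]

theorem map_add_int (h : IsCurveLift f φ g) (x : ℝ) (m : ℤ) : φ (x + m) = φ x :=
  h.eq_iff.2 ⟨m, rfl⟩

theorem exists_mem_Ico_eq (h : IsCurveLift f φ g) (u x : ℝ) : ∃ y ∈ Ico u (u + 1), φ y = φ x :=
  ⟨toIcoMod one_pos u x, toIcoMod_mem_Ico one_pos u x, h.eq_iff.2 ⟨-toIcoDiv one_pos u x, by
    rw [toIcoMod, zsmul_one, Int.cast_neg, sub_eq_add_neg]⟩⟩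

theorem injOn_Icc (h : IsCurveLift f φ g) {a b : ℝ} (hab : b < a + 1) : InjOn φ (Icc a b) := by
  intro x hx y hy hxy
  obtain ⟨m, rfl⟩ := h.eq_iff.1 hxy
  have hm : |(m : ℝ)| < 1 := abs_lt.2 ⟨by linarith [hx.1, hy.2], by linarith [hx.2, hy.1]⟩
  obtain rfl : m = 0 := Int.abs_lt_one_iff.1 (by exact_mod_cast hm)
  rw [Int.cast_zero, add_zero]

theorem injective (h : IsCurveLift f φ g) (hfib : ∀ c, {p ∈ range φ | f p = c}.Finite) :
    Injective g := by
  refine injective_of_monotone_of_finite_fibers g.monotone fun c => ?_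
  have hinj : InjOn φ (g ⁻¹' {c}) := by
    intro x (hx : g x = c) y (hy : g y = c) hxy
    obtain ⟨m, rfl⟩ := h.eq_iff.1 hxy
    rw [g.map_add_int, hy, add_eq_left] at hx
    rw [hx, add_zero]
  refine Finite.of_finite_image ((hfib (φ c)).subset ?_) hinj
  rintro _ ⟨x, hx : g x = c, rfl⟩
  exact ⟨mem_range_self x, by rw [← h.semiconj.eq, hx]⟩

theorem continuous_lift (h : IsCurveLift f φ g) (hf : SurjOn f (range φ) (range φ)) :
    Continuous g := by
  refine g.monotone.continuous_of_surjective fun y => ?_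
  obtain ⟨_, ⟨x, rfl⟩, hx⟩ := hf (mem_range_self y)
  obtain ⟨m, hm⟩ := h.eq_iff.1 (hx.symm.trans (h.semiconj x).symm)
  exact ⟨x + m, by rw [g.map_add_int, hm]⟩

theorem exists_common_period (h : IsCurveLift f φ g) {u : ℝ} (hu : φ u ∈ periodicPts f) :
    ∃ n : ℕ, 0 < n ∧ ∃ m : ℤ, ∀ x, φ x ∈ periodicPts f → (g ^ n) x = x + m := by
  obtain ⟨n, hn, hun⟩ := hu
  obtain ⟨m, hm⟩ := h.iterate_eq_self_iff.1 hun
  refine ⟨n, hn, m, ?_⟩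
  rintro x ⟨n', hn', hxn'⟩
  obtain ⟨m', hm'⟩ := h.iterate_eq_self_iff.1 hxn'
  exact circleDeg1Lift_pow_eq_add_int hn hn' hm hm'

end IsCurveLift

end CurveLift

section Rigidity

theorem exists_Ioo_disjoint_of_isClosed {α : Type*} [LinearOrder α] [TopologicalSpace α]
    [OrderClosedTopology α] [CompactIccSpace α] {S : Set α} (hS : IsClosed S) {u v x : α}
    (hu : u ∈ S) (hv : v ∈ S) (hx : x ∈ Icc u v) (hxS : x ∉ S) :
    ∃ a ∈ S, ∃ b ∈ S, x ∈ Ioo a b ∧ Icc a b ⊆ Icc u v ∧ Disjoint (Ioo a b) S := by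
  obtain ⟨a, ⟨haS, hua, hax⟩, ha⟩ := (isCompact_Icc.inter_left hS).exists_isGreatest
    ⟨u, hu, left_mem_Icc.2 hx.1⟩
  obtain ⟨b, ⟨hbS, hxb, hbv⟩, hb⟩ := (isCompact_Icc.inter_left hS).exists_isLeast
    ⟨v, hv, right_mem_Icc.2 hx.2⟩
  refine ⟨a, haS, b, hbS, ⟨hax.lt_of_ne (ne_of_mem_of_not_mem haS hxS),
    hxb.lt_of_ne' (ne_of_mem_of_not_mem hbS hxS)⟩, Icc_subset_Icc hua hbv, ?_⟩
  refine disjoint_left.2 fun z hz hzS => (le_total z x).elim (fun hzx => ?_) fun hxz => ?_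
  · exact hz.1.not_ge (ha ⟨hzS, hua.trans hz.1.le, hzx⟩)
  · exact hz.2.not_ge (hb ⟨hzS, hxz, hz.2.le.trans hbv⟩)

theorem pow_apply_pow_eq_add_int_iff {g : CircleDeg1Lift} (hg : Injective g) {n j : ℕ} {m : ℤ}
    {x : ℝ} : (g ^ n) ((g ^ j) x) = (g ^ j) x + m ↔ (g ^ n) x = x + m := by
  have hgj : Injective (g ^ j) := g.coe_pow j ▸ hg.iterate j
  rw [← CircleDeg1Lift.mul_apply, (Commute.pow_pow_self g n j).eq, CircleDeg1Lift.mul_apply,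
    ← CircleDeg1Lift.map_add_int, hgj.eq_iff]

/-- On every connected part of `Γ` avoiding the break set `B`, the map `f` is special affine. -/
def IsPiecewiseSpecialAffineOn {V : Type*} [AddCommGroup V] [Module ℝ V] [TopologicalSpace V]
    (f : V → V) (B Γ : Set V) : Prop :=
  ∀ T ⊆ Γ \ B, IsPreconnected T → ∃ M, IsSpecialAffine M ∧ EqOn f M T

theorem IsPiecewiseSpecialAffineOn.mono {V : Type*} [AddCommGroup V] [Module ℝ V]
    [TopologicalSpace V] {f : V → V} {B Γ Γ' : Set V} (hf : IsPiecewiseSpecialAffineOn f B Γ)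
    (h : Γ' ⊆ Γ) : IsPiecewiseSpecialAffineOn f B Γ' :=
  fun T hT => hf T (hT.trans (sdiff_subset_sdiff_left h))

namespace IsCurveLift

theorem exists_isSpecialAffine_pow {V : Type*} [AddCommGroup V] [Module ℝ V] [TopologicalSpace V]
    {f : V → V} {B : Set V} {φ : ℝ → V} {g : CircleDeg1Lift} (h : IsCurveLift f φ g)
    (hgc : Continuous g) (hf : IsPiecewiseSpecialAffineOn f B (range φ)) {I : Set ℝ}
    (hI : IsPreconnected I) (hIB : ∀ x ∈ I, ∀ j, φ ((g ^ j) x) ∉ B) (n : ℕ) :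
    ∃ M, IsSpecialAffine M ∧ EqOn (fun x => φ ((g ^ n) x)) (M ∘ φ) I := by
  induction n with
  | zero => exact ⟨id, .id, fun x _ => rfl⟩
  | succ n ih =>
    obtain ⟨M, hM, hMI⟩ := ih
    have hcont : Continuous fun x => φ ((g ^ n) x) :=
      h.continuous.comp (g.coe_pow n ▸ hgc.iterate n)
    obtain ⟨N, hN, hfN⟩ := hf ((fun x => φ ((g ^ n) x)) '' I)
      (image_subset_iff.2 fun x hx => ⟨mem_range_self _, hIB x hx n⟩)
      (hI.image _ hcont.continuousOn)
    refine ⟨N ∘ M, hN.comp hM, fun x hx => ?_⟩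
    calc φ ((g ^ (n + 1)) x) = f (φ ((g ^ n) x)) := by
          rw [pow_succ', CircleDeg1Lift.mul_apply, h.semiconj.eq]
      _ = N (φ ((g ^ n) x)) := hfN (mem_image_of_mem _ hx)
      _ = N (M (φ x)) := congrArg N (hMI hx)

variable {V : Type*} [NormedAddCommGroup V] [NormedSpace ℝ V] {f : V → V} {B : Set V} {φ : ℝ → V}
  {g : CircleDeg1Lift} {n : ℕ} {m : ℤ} {a b : ℝ}

theorem pow_eq_add_int_of_forall_notMem (hV : finrank ℝ V = 2) (h : IsCurveLift f φ g)
    (hgc : Continuous g) (hf : IsPiecewiseSpecialAffineOn f B (range φ)) (hab : a < b)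
    (hba : b < a + 1) (ha : (g ^ n) a = a + m) (hb : (g ^ n) b = b + m)
    (hB : ∀ x ∈ Ioo a b, ∀ j, φ ((g ^ j) x) ∉ B) {x : ℝ} (hx : x ∈ Icc a b) :
    (g ^ n) x = x + m := by
  have : FiniteDimensional ℝ V := .of_finrank_pos (by lia)
  obtain ⟨M, hM, hMab⟩ := h.exists_isSpecialAffine_pow hgc hf isPreconnected_Ioo hB n
  replace hMab : EqOn (fun x => φ ((g ^ n) x)) (M ∘ φ) (Icc a b) := by
    rw [← closure_Ioo hab.ne]
    exact hMab.closure (h.continuous.comp (g.coe_pow n ▸ hgc.iterate n))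
      (hM.continuous.comp h.continuous)
  have hmem {y : ℝ} (hy : y ∈ Icc a b) : (g ^ n) y - m ∈ Icc a b := by
    have h1 := (g ^ n).monotone hy.1
    have h2 := (g ^ n).monotone hy.2
    rw [ha] at h1
    rw [hb] at h2
    exact ⟨by linarith, by linarith⟩
  have hMφ {y : ℝ} (hy : y ∈ Icc a b) : M (φ y) = φ ((g ^ n) y - m) := by
    rw [← h.map_add_int (_ - _) m, sub_add_cancel]
    exact (hMab hy).symm
  have hMfix : EqOn M id (φ '' Icc a b) := by
    have hfix {y : ℝ} (hy : y ∈ Icc a b) (hgy : (g ^ n) y = y + m) : M (φ y) = φ y := by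
      rw [hMφ hy, hgy, add_sub_cancel_right]
    have haI := left_mem_Icc.2 hab.le
    have hbI := right_mem_Icc.2 hab.le
    refine hM.eqOn_id_of_mapsTo hV (hfix haI ha) (hfix hbI hb)
      ((h.injOn_Icc hba).ne haI hbI hab.ne) (isCompact_Icc.image h.continuous).isBounded ?_
    rintro _ ⟨y, hy, rfl⟩
    exact hMφ hy ▸ mem_image_of_mem φ (hmem hy)
  have hφx : φ ((g ^ n) x - m) = φ x := (hMφ hx).symm.trans (hMfix (mem_image_of_mem φ hx))
  exact sub_eq_iff_eq_add.1 (h.injOn_Icc hba (hmem hx) hx hφx)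

theorem pow_eq_add_int_of_mem_Icc (hV : finrank ℝ V = 2) (h : IsCurveLift f φ g)
    (hgc : Continuous g) (hgi : Injective g) (hf : IsPiecewiseSpecialAffineOn f B (range φ))
    (hB : ∀ x, φ x ∈ B → (g ^ n) x = x + m) (hba : b < a + 1) (ha : (g ^ n) a = a + m)
    (hb : (g ^ n) b = b + m) {x : ℝ} (hx : x ∈ Icc a b) : (g ^ n) x = x + m := by
  by_contra hxS
  have hgn : Continuous (g ^ n) := g.coe_pow n ▸ hgc.iterate n
  obtain ⟨a', ha', b', hb', hx', hsub, hdisj⟩ := exists_Ioo_disjoint_of_isClosed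
    (isClosed_eq hgn (continuous_add_const (m : ℝ))) ha hb hx hxS
  have hab' : a' < b' := hx'.1.trans hx'.2
  have ha'I := hsub (left_mem_Icc.2 hab'.le)
  have hb'I := hsub (right_mem_Icc.2 hab'.le)
  refine hxS (h.pow_eq_add_int_of_forall_notMem hV hgc hf hab' (by linarith [ha'I.1, hb'I.2])
    ha' hb' (fun z hz j hj => disjoint_left.1 hdisj hz ?_) (Ioo_subset_Icc_self hx'))
  exact (pow_apply_pow_eq_add_int_iff hgi).1 (hB _ hj)

end IsCurveLift

/-- The common period of the break points is a period of the two arcs between `u` and `v`. -/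
theorem exists_iterate_eq_self_of_isCurveLift {V : Type*} [NormedAddCommGroup V] [NormedSpace ℝ V]
    (hV : finrank ℝ V = 2) {f : V → V} {φ : ℝ → V} {g : CircleDeg1Lift} (h : IsCurveLift f φ g)
    (hsurj : SurjOn f (range φ) (range φ)) (hfib : ∀ c, {p ∈ range φ | f p = c}.Finite) {B : Set V}
    (hf : IsPiecewiseSpecialAffineOn f B (range φ)) (hB : range φ ∩ B ⊆ periodicPts f)
    (hnt : (range φ ∩ B).Nontrivial) : ∃ n : ℕ, 0 < n ∧ ∀ p ∈ range φ, f^[n] p = p := by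
  have hgc := h.continuous_lift hsurj
  have hgi := h.injective hfib
  obtain ⟨_, ⟨⟨u, rfl⟩, huB⟩, _, ⟨⟨w, rfl⟩, hwB⟩, huw⟩ := hnt
  obtain ⟨v, hv, hvw⟩ := h.exists_mem_Ico_eq u w
  rw [← hvw] at hwB huw
  obtain ⟨n, hn, m, hper⟩ := h.exists_common_period (hB ⟨mem_range_self u, huB⟩)
  have hBfix (x : ℝ) (hx : φ x ∈ B) : (g ^ n) x = x + m := hper x (hB ⟨mem_range_self x, hx⟩)
  have huv : u < v := hv.1.lt_of_ne fun e => huw (congrArg φ e)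
  have hφu : φ (u + 1) = φ u := by exact_mod_cast h.map_add_int u 1
  refine ⟨n, hn, ?_⟩
  rintro _ ⟨x, rfl⟩
  obtain ⟨y, hy, hyx⟩ := h.exists_mem_Ico_eq u x
  rw [← hyx, h.iterate_eq_self_iff]
  refine ⟨m, (le_total y v).elim (fun hyv => ?_) fun hvy => ?_⟩
  · exact h.pow_eq_add_int_of_mem_Icc hV hgc hgi hf hBfix hv.2 (hBfix u huB) (hBfix v hwB)
      ⟨hy.1, hyv⟩
  · exact h.pow_eq_add_int_of_mem_Icc hV hgc hgi hf hBfix (by linarith) (hBfix v hwB)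
      (hBfix _ (hφu ▸ huB)) ⟨hvy, hy.2.le⟩

end Rigidity

section Topology

theorem exists_subset_of_isPreconnected {X ι : Type*} [TopologicalSpace X] [Finite ι] {T : Set X}
    (hT : IsPreconnected T) (hne : T.Nonempty) {K : ι → Set X} (hK : ∀ k, IsClosed (K k))
    (hcov : T ⊆ ⋃ k, K k) (hdisj : ∀ k l, k ≠ l → Disjoint T (K k ∩ K l)) : ∃ k, T ⊆ K k := by
  obtain ⟨x, hx⟩ := hne
  obtain ⟨k, hxk⟩ := mem_iUnion.1 (hcov hx)
  have hunique {l : ι} {y : X} (hy : y ∈ T) (hk : y ∈ K k) (hl : y ∈ K l) : l = k := by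
    by_contra hlk
    exact disjoint_left.1 (hdisj l k hlk) hy ⟨hl, hk⟩
  have hcl : IsClosed (⋃ l ∈ ({k}ᶜ : Set ι), K l) :=
    (toFinite _).isClosed_biUnion fun l _ => hK l
  refine ⟨k, (isPreconnected_iff_subset_of_disjoint_closed.1 hT _ _ (hK k) hcl ?_ ?_).resolve_right
    fun h => ?_⟩
  · intro y hy
    obtain ⟨l, hl⟩ := mem_iUnion.1 (hcov hy)
    by_cases hlk : l = k
    · exact .inl (hlk ▸ hl)
    · exact .inr (mem_biUnion hlk hl)
  · rw [eq_empty_iff_forall_notMem]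
    rintro y ⟨hy, hyk, hyl⟩
    obtain ⟨l, hlk, hl⟩ := mem_iUnion₂.1 hyl
    exact hlk (hunique hy hyk hl)
  · obtain ⟨l, hlk, hl⟩ := mem_iUnion₂.1 (h hx)
    exact hlk (hunique hx hxk hl)

theorem inter_nonempty_of_isPreconnected {X : Type*} [TopologicalSpace X] [Bornology X]
    {K Γ : Set X} {z : X} (hK : IsPreconnected K) (hz : z ∈ K)
    (hΓ : IsBounded (connectedComponentIn Γᶜ z)) (hKb : ¬IsBounded K) : (Γ ∩ K).Nonempty := by
  by_contra hne
  rw [not_nonempty_iff_eq_empty, ← disjoint_iff_inter_eq_empty] at hne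
  exact hKb (hΓ.subset (hK.subset_connectedComponentIn hz hne.symm.subset_compl_right))

theorem not_isBounded_lineMap_image_Ici {V : Type*} [NormedAddCommGroup V] [NormedSpace ℝ V]
    {p q : V} (hpq : p ≠ q) : ¬IsBounded (AffineMap.lineMap p q '' Ici (0 : ℝ)) := by
  intro h
  have hsub : IsBounded ((AffineMap.lineMap p q '' Ici (0 : ℝ) : Set V) - {p}) :=
    h.sub isBounded_singleton
  refine hpq (sub_eq_zero.1 (eq_zero_of_isBounded_range_nsmul (hsub.subset ?_))).symm
  rintro _ ⟨n, rfl⟩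
  refine ⟨_, mem_image_of_mem _ (mem_Ici.2 n.cast_nonneg), p, rfl, ?_⟩
  simp only [AffineMap.lineMap_apply_module', add_sub_cancel_right, Nat.cast_smul_eq_nsmul]

end Topology

section Geometry

theorem fin_cyclic_induction {n : ℕ} {P : Fin (n + 1) → Prop} (h0 : P 0)
    (hsucc : ∀ i, P i → P (i + 1)) (i : Fin (n + 1)) : P i :=
  Fin.induction h0 (fun _ hi => Fin.coeSucc_eq_succ ▸ hsucc _ hi) i

theorem finrank_real_prod : finrank ℝ (ℝ × ℝ) = 2 := by
  rw [finrank_prod, finrank_self]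

theorem mem_convexHull_triple {V : Type*} [AddCommGroup V] [Module ℝ V] {a b c p : V} :
    p ∈ convexHull ℝ {a, b, c} ↔
      ∃ α β γ : ℝ, 0 ≤ α ∧ 0 ≤ β ∧ 0 ≤ γ ∧ α + β + γ = 1 ∧ α • a + β • b + γ • c = p := by
  constructor
  · intro h
    rw [convexHull_insert (insert_nonempty _ _), convexHull_pair, convexJoin_singleton_left] at h
    simp only [mem_iUnion] at h
    obtain ⟨q, ⟨β, γ, hβ, hγ, hβγ, rfl⟩, ⟨α, δ, hα, hδ, hαδ, rfl⟩⟩ := h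
    refine ⟨α, δ * β, δ * γ, hα, by positivity, by positivity, ?_, ?_⟩
    · linear_combination hαδ + δ * hβγ
    · simp only [smul_add, smul_smul, add_assoc]
  · rintro ⟨α, β, γ, hα, hβ, hγ, hsum, rfl⟩
    refine mem_convexHull_of_exists_fintype ![α, β, γ] ![a, b, c] ?_ ?_ ?_ ?_
    · simp [Fin.forall_fin_succ, hα, hβ, hγ]
    · simpa [Fin.sum_univ_three] using hsum
    · simp [Fin.forall_fin_succ]
    · simp [Fin.sum_univ_three]

theorem isSpecialAffine_rot : IsSpecialAffine rot :=
  isSpecialAffine_of_coordinates 0 (-1) 1 0 1 0 (by norm_num) fun p => by simp [rot]; ring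

theorem isSpecialAffine_rotInv : IsSpecialAffine rotInv :=
  isSpecialAffine_of_coordinates 0 1 (-1) 0 0 1 (by norm_num) fun p => by simp [rotInv]; ring

theorem isSpecialAffine_shear (θ : ℝ) : IsSpecialAffine (shear θ) :=
  isSpecialAffine_of_coordinates 1 ((1 - 2 * s θ) / t θ) 0 1 0 0 (by norm_num)
    fun p => by simp [shear]

theorem isSpecialAffine_scaling {θ : ℝ} (hθ : θ ∈ Ioo 0 (Real.pi / 4)) :
    IsSpecialAffine (scaling θ) := by
  have hst : t θ - s θ ≠ 0 := (sub_neg.2 (t_lt_s hθ)).ne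
  refine isSpecialAffine_of_coordinates ((t θ ^ 2 - (1 - s θ) ^ 2) / (t θ - s θ))
    ((1 - 2 * s θ) * t θ / (t θ - s θ)) ((2 * s θ - 1) * t θ / (t θ - s θ))
    ((2 * t θ - 1) * t θ / (t θ - s θ)) 0 0 ?_ fun p => ?_
  · field_simp
    linear_combination (2 * t θ ^ 2 + t θ - 1) * st_rel θ
  · ext <;> simp only [scaling] <;> ring

theorem rot_rotInv : RightInverse rotInv rot := fun p => by simp [rot, rotInv]

theorem rotInv_rot : LeftInverse rotInv rot := fun p => by simp [rot, rotInv]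

theorem rotInv_mem_rect {p : ℝ × ℝ} (hp : p ∈ rect) : rotInv p ∈ rect := by
  obtain ⟨⟨hx0, hx1⟩, hy⟩ := hp
  exact ⟨hy, sub_nonneg.2 hx1, sub_le_self _ hx0⟩

theorem rot_E (i : Fin 4) : rot (E i) = E (i + 1) := by
  fin_cases i <;> simp [rot, E]

theorem rot_P (θ : ℝ) (i : Fin 4) : rot (P θ i) = P θ (i + 1) := by
  fin_cases i <;> simp [rot, P]

theorem mem_pieceA_succ {θ : ℝ} {i : Fin 4} {p : ℝ × ℝ} :
    p ∈ pieceA θ (i + 1) ↔ rotInv p ∈ pieceA θ i := by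
  suffices rot '' pieceA θ i = pieceA θ (i + 1) by
    rw [← this, image_eq_preimage_of_inverse rotInv_rot rot_rotInv, mem_preimage]
  simp only [pieceA, isSpecialAffine_rot.image_convexHull, image_insert_eq, image_singleton, rot_E,
    rot_P]

theorem mem_pieceB_succ {θ : ℝ} {i : Fin 4} {p : ℝ × ℝ} :
    p ∈ pieceB θ (i + 1) ↔ rotInv p ∈ pieceB θ i := by
  suffices rot '' pieceB θ i = pieceB θ (i + 1) by
    rw [← this, image_eq_preimage_of_inverse rotInv_rot rot_rotInv, mem_preimage]
  simp only [pieceB, isSpecialAffine_rot.image_convexHull, image_insert_eq, image_singleton, rot_E,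
    rot_P, sub_add_eq_add_sub]

variable {θ : ℝ}

theorem mem_pieceA_zero (hθ : θ ∈ Ioo 0 (Real.pi / 4)) {p : ℝ × ℝ} :
    p ∈ pieceA θ 0 ↔ 0 ≤ p.2 ∧ s θ * p.2 ≤ t θ * p.1 ∧
      (1 - s θ) * p.2 ≤ t θ * (1 - p.1) := by
  have ht := t_pos hθ
  rw [pieceA, mem_convexHull_triple]
  constructor
  · rintro ⟨α, β, γ, hα, hβ, hγ, h, rfl⟩
    obtain rfl : α = 1 - β - γ := by linarith
    simp only [zero_add, E, P, Prod.fst_add, Prod.snd_add, Prod.smul_fst, Prod.smul_snd,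
      Matrix.cons_val_zero, Matrix.cons_val_one, smul_eq_mul]
    exact ⟨by nlinarith, by nlinarith, by nlinarith⟩
  · rintro ⟨hy, hEP, hE'P⟩
    obtain ⟨x, y⟩ := p
    refine ⟨(t θ * (1 - x) - (1 - s θ) * y) / t θ, (t θ * x - s θ * y) / t θ, y / t θ,
      div_nonneg (sub_nonneg.2 hE'P) ht.le, div_nonneg (sub_nonneg.2 hEP) ht.le,
      div_nonneg hy ht.le, ?_, ?_⟩
    · field_simp
      ring
    · ext <;> simp [E, P] <;> field_simp
      ring

theorem mem_pieceB_zero (hθ : θ ∈ Ioo 0 (Real.pi / 4)) {p : ℝ × ℝ} :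
    p ∈ pieceB θ 0 ↔ t θ * p.1 ≤ s θ * p.2 ∧ s θ * p.1 + t θ * p.2 ≤ t θ ∧
      t θ * p.2 ≤ (1 - s θ) * p.1 := by
  have ht := t_pos hθ
  have hrel := st_rel θ
  have hst : 0 < s θ - t θ := sub_pos.2 (t_lt_s hθ)
  rw [pieceB, mem_convexHull_triple]
  constructor
  · rintro ⟨α, β, γ, hα, hβ, hγ, h, rfl⟩
    obtain rfl : α = 1 - β - γ := by linarith
    simp only [E, P, Matrix.cons_val_zero, Matrix.cons_val, Prod.smul_mk, smul_eq_mul, mul_zero,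
      Prod.mk_add_mk, zero_add, zero_sub]
    refine ⟨?_, ?_, ?_⟩
    · nlinarith [mul_nonneg hγ hst.le]
    · nlinarith [mul_nonneg hγ hst.le]
    · nlinarith [mul_nonneg hβ hst.le]
  · rintro ⟨hEP, hPP, hEP'⟩
    obtain ⟨x, y⟩ := p
    dsimp only at hEP hPP hEP'
    refine ⟨(t θ - s θ * x - t θ * y) / t θ, ((1 - s θ) * x - t θ * y) / (s θ - t θ),
      (s θ * y - t θ * x) / (s θ - t θ), div_nonneg (by linarith) ht.le,
      div_nonneg (by linarith) hst.le, div_nonneg (by linarith) hst.le, ?_, ?_⟩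
    · have := hst.ne'
      field_simp
      linear_combination (-x) * hrel
    · have := hst.ne'
      ext <;> simp [E, P] <;> field_simp
      · linear_combination (-x) * hrel
      · linear_combination (-y) * hrel

theorem P_mem_pieceC (i : Fin 4) : P θ i ∈ pieceC θ := by
  apply subset_convexHull
  fin_cases i <;> simp

theorem mem_pieceC_of_le (hθ : θ ∈ Ioo 0 (Real.pi / 4)) {p : ℝ × ℝ}
    (h0 : t θ * p.1 ≤ s θ * p.2) (h1 : t θ * p.2 ≤ s θ * (1 - p.1))
    (h2 : t θ * (1 - p.1) ≤ s θ * (1 - p.2)) (h3 : t θ * (1 - p.2) ≤ s θ * p.1) :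
    p ∈ pieceC θ := by
  have hrel := st_rel θ
  have hst : 0 < s θ - t θ := sub_pos.2 (t_lt_s hθ)
  have hC : Convex ℝ (pieceC θ) := convex_convexHull ℝ _
  obtain ⟨x, y⟩ := p
  dsimp only at h0 h1 h2 h3
  -- the coordinates of `p` in the directions of the sides `P 0 P 1` and `P 0 P 3`
  set u := (s θ * x - t θ * (1 - y)) / (s θ - t θ) with hu
  set v := (s θ * y - t θ * x) / (s θ - t θ) with hv
  have hu0 : 0 ≤ u := div_nonneg (by linarith) hst.le
  have hv0 : 0 ≤ v := div_nonneg (by linarith) hst.le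
  have hu1 : 0 ≤ 1 - u := by rw [sub_nonneg, hu, div_le_one hst]; linarith
  have hv1 : 0 ≤ 1 - v := by rw [sub_nonneg, hv, div_le_one hst]; linarith
  have hbot := hC (P_mem_pieceC 0) (P_mem_pieceC 1) hu1 hu0 (sub_add_cancel _ _)
  have htop := hC (P_mem_pieceC 3) (P_mem_pieceC 2) hu1 hu0 (sub_add_cancel _ _)
  convert hC hbot htop hv1 hv0 (sub_add_cancel _ _) using 1
  have := hst.ne'
  ext <;> simp [P, hu, hv] <;> field_simp
  · linear_combination ((s θ - t θ) * (x + y - 1)) * hrel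
  · linear_combination ((s θ - t θ) * (y - x)) * hrel

/-- The right triangle with hypotenuse `E i E (i + 1)` cut off by the lines through `E i P i` and
`E (i + 1) P (i + 1)`. The four sectors form a pinwheel around the centre square. -/
def sector (θ : ℝ) (i : Fin 4) : Set (ℝ × ℝ) :=
  pieceA θ i ∪ pieceB θ (i + 1)

theorem mem_sector_succ {i : Fin 4} {p : ℝ × ℝ} :
    p ∈ sector θ (i + 1) ↔ rotInv p ∈ sector θ i :=
  or_congr mem_pieceA_succ mem_pieceB_succ

theorem mem_sector_zero (hθ : θ ∈ Ioo 0 (Real.pi / 4)) {p : ℝ × ℝ} :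
    p ∈ sector θ 0 ↔ 0 ≤ p.2 ∧ s θ * p.2 ≤ t θ * p.1 ∧ t θ * p.2 ≤ s θ * (1 - p.1) := by
  have ht := t_pos hθ
  have hrel := st_rel θ
  have hst : 0 < s θ - t θ := sub_pos.2 (t_lt_s hθ)
  have hs : 0 < s θ := ht.trans (t_lt_s hθ)
  rw [sector, mem_union, mem_pieceB_succ, mem_pieceA_zero hθ, mem_pieceB_zero hθ]
  dsimp only [rotInv]
  constructor
  · rintro (⟨hy, hEP, hE'P⟩ | ⟨hE'P, hPP, hEP⟩)
    · refine ⟨hy, hEP, le_of_mul_le_mul_left ?_ ht⟩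
      linear_combination s θ * hE'P + mul_nonneg hst.le hy + p.2 * hrel
    · refine ⟨le_of_mul_le_mul_left ?_ hst, by linarith, hE'P⟩
      linear_combination s θ * hEP + t θ * hE'P - p.2 * hrel
  · rintro ⟨hy, hEP, hE'P⟩
    obtain h | h := le_total ((1 - s θ) * p.2) (t θ * (1 - p.1))
    · exact .inl ⟨hy, hEP, h⟩
    · exact .inr ⟨hE'P, by linarith, h⟩

theorem sector_inter_sector_succ_subset (hθ : θ ∈ Ioo 0 (Real.pi / 4)) (i : Fin 4) :
    sector θ i ∩ sector θ (i + 1) ⊆ pieceA θ (i + 1) ∩ pieceB θ (i + 1) := by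
  induction i using fin_cyclic_induction with
  | hsucc i ih =>
    rintro p ⟨hi, hi'⟩
    rw [mem_inter_iff, mem_pieceA_succ, mem_pieceB_succ]
    exact ih ⟨mem_sector_succ.1 hi, mem_sector_succ.1 hi'⟩
  | h0 =>
    rintro p ⟨h0, h1⟩
    rw [mem_inter_iff, mem_pieceA_succ, mem_pieceB_succ, mem_pieceA_zero hθ, mem_pieceB_zero hθ]
    rw [mem_sector_succ, mem_sector_zero hθ] at h1
    rw [mem_sector_zero hθ] at h0
    have ht := t_pos hθ
    have hrel := st_rel θ
    have hst : 0 < s θ - t θ := sub_pos.2 (t_lt_s hθ)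
    dsimp only [rotInv] at h1 ⊢
    have hEP : t θ * p.2 = s θ * (1 - p.1) := by linarith
    have hP : 1 - p.1 ≤ t θ := by
      refine le_of_mul_le_mul_left ?_ ht
      linear_combination t θ * h0.2.1 - s θ * hEP + (p.1 - 1) * hrel
    refine ⟨⟨h1.1, h1.2.1, by linarith⟩, ⟨by linarith, by linarith, ?_⟩⟩
    refine le_of_mul_le_mul_left ?_ ht
    linear_combination mul_nonneg hst.le h1.1 + (s θ - 1) * hEP + (1 - p.1) * hrel

theorem disjoint_sector_add_two (hθ : θ ∈ Ioo 0 (Real.pi / 4)) (i : Fin 4) :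
    Disjoint (sector θ i) (sector θ (i + 2)) := by
  rw [show i + 2 = i + 1 + 1 by rw [add_assoc]; rfl, disjoint_left]
  induction i using fin_cyclic_induction with
  | hsucc i ih => exact fun p hi hi' => ih (mem_sector_succ.1 hi) (mem_sector_succ.1 hi')
  | h0 =>
    intro p h0 h2
    rw [mem_sector_succ, mem_sector_succ, mem_sector_zero hθ] at h2
    rw [mem_sector_zero hθ] at h0
    dsimp only [rotInv] at h2
    linarith [t_lt_s hθ]

theorem rect_subset_iUnion_sector_union_pieceC (hθ : θ ∈ Ioo 0 (Real.pi / 4)) :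
    rect ⊆ (⋃ i, sector θ i) ∪ pieceC θ := by
  intro p hp
  rw [mem_union, mem_iUnion, or_iff_not_imp_left, not_exists]
  intro hpS
  let N : Set (ℝ × ℝ) := {q | q ∈ rect ∧ ∀ i, q ∉ sector θ i}
  have hN : MapsTo rotInv N N := fun q hq => ⟨rotInv_mem_rect hq.1, fun i hi =>
    hq.2 (i + 1) (mem_sector_succ.2 hi)⟩
  have hstep (q) (hq : q ∈ N) (hlt : s θ * q.2 < t θ * q.1) :
      s θ * (rotInv q).2 < t θ * (rotInv q).1 := by
    by_contra! hle
    exact hq.2 0 ((mem_sector_zero hθ).2 ⟨hq.1.2.1, hlt.le, hle⟩)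
  -- otherwise going around the square gives four inequalities which add up to `2 * s θ < 2 * t θ`
  have hline (q) (hq : q ∈ N) : t θ * q.1 ≤ s θ * q.2 := by
    by_contra! h0
    have h1 := hstep _ hq h0
    have h2 := hstep _ (hN hq) h1
    have h3 := hstep _ (hN (hN hq)) h2
    dsimp only [rotInv] at h1 h2 h3
    linarith [t_lt_s hθ]
  have h1 : rotInv p ∈ N := hN ⟨hp, hpS⟩
  have h2 : rotInv (rotInv p) ∈ N := hN h1
  refine mem_pieceC_of_le hθ (hline p ⟨hp, hpS⟩) (hline _ h1) (hline _ h2) ?_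
  simpa [rotInv] using hline _ (hN h2)

/-- The eight triangles around the centre square, paired so that `sector θ i` consists of the
triangles with indices `(i, true)` and `(i, false)`. -/
noncomputable def piece (θ : ℝ) : Fin 4 × Bool → Set (ℝ × ℝ)
  | (i, true) => pieceA θ i
  | (i, false) => pieceB θ (i + 1)

/-- The affine map which `F θ` is on `piece θ k`. -/
noncomputable def pieceMap (θ : ℝ) : Fin 4 × Bool → ℝ × ℝ → ℝ × ℝ
  | (i, true) => mapA θ i
  | (i, false) => mapB θ (i + 1)

/-- The union of the eight break segments. -/
def breakSet (θ : ℝ) : Set (ℝ × ℝ) :=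
  ⋃ i, (pieceB θ i ∩ pieceA θ i) ∪ (pieceA θ i ∩ pieceB θ (i + 1))

theorem piece_subset_sector (θ : ℝ) : ∀ k, piece θ k ⊆ sector θ k.1
  | (_, true) => subset_union_left
  | (_, false) => subset_union_right

theorem isClosed_piece (θ : ℝ) : ∀ k, IsClosed (piece θ k)
  | (_, true) => (toFinite _).isClosed_convexHull ℝ
  | (_, false) => (toFinite _).isClosed_convexHull ℝ

theorem isSpecialAffine_pieceMap (hθ : θ ∈ Ioo 0 (Real.pi / 4)) :
    ∀ k, IsSpecialAffine (pieceMap θ k)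
  | (i, true) => (isSpecialAffine_rot.iterate i).comp
      ((isSpecialAffine_shear θ).comp (isSpecialAffine_rotInv.iterate i))
  | (i, false) => (isSpecialAffine_rot.iterate _).comp
      ((isSpecialAffine_scaling hθ).comp (isSpecialAffine_rotInv.iterate (i + 1 : Fin 4)))

theorem iUnion_piece (θ : ℝ) : ⋃ k, piece θ k = ⋃ i, sector θ i := by
  ext p
  simp only [mem_iUnion, Prod.exists, Bool.exists_bool, piece, sector, mem_union, or_comm]

theorem piece_inter_piece_subset_breakSet (hθ : θ ∈ Ioo 0 (Real.pi / 4)) {k l : Fin 4 × Bool}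
    (hkl : k ≠ l) : piece θ k ∩ piece θ l ⊆ breakSet θ := by
  rintro p ⟨hk, hl⟩
  have hi := piece_subset_sector θ k hk
  have hj := piece_subset_sector θ l hl
  obtain ⟨i, b⟩ := k
  obtain ⟨j, c⟩ := l
  have hadj {i : Fin 4} (hi : p ∈ sector θ i) (hi' : p ∈ sector θ (i + 1)) : p ∈ breakSet θ :=
    mem_iUnion.2 ⟨i + 1, .inl (sector_inter_sector_succ_subset hθ i ⟨hi, hi'⟩).symm⟩
  obtain rfl | rfl | rfl | rfl : j = i ∨ j = i + 1 ∨ j = i + 2 ∨ i = j + 1 := by lia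
  · cases b <;> cases c
    · exact absurd rfl hkl
    · exact mem_iUnion.2 ⟨j, .inr ⟨hl, hk⟩⟩
    · exact mem_iUnion.2 ⟨j, .inr ⟨hk, hl⟩⟩
    · exact absurd rfl hkl
  · exact hadj hi hj
  · exact absurd hj (disjoint_left.1 (disjoint_sector_add_two hθ i) hi)
  · exact hadj hj hi

theorem exists_mem_piece_F_eq_pieceMap (hθ : θ ∈ Ioo 0 (Real.pi / 4)) {p : ℝ × ℝ}
    (hp : p ∈ rect \ pieceC θ) : ∃ k, p ∈ piece θ k ∧ F θ p = pieceMap θ k p := by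
  unfold F
  split_ifs with h h h h h h h h
  · exact ⟨(0, true), h, rfl⟩
  · exact ⟨(1, true), h, rfl⟩
  · exact ⟨(2, true), h, rfl⟩
  · exact ⟨(3, true), h, rfl⟩
  · exact ⟨(3, false), h, rfl⟩
  · exact ⟨(0, false), h, rfl⟩
  · exact ⟨(1, false), h, rfl⟩
  · exact ⟨(2, false), h, rfl⟩
  · exact absurd ‹_› hp.2
  · obtain hS | hC := rect_subset_iUnion_sector_union_pieceC hθ hp.1
    · rw [← iUnion_piece, mem_iUnion] at hS
      obtain ⟨⟨i, _ | _⟩, hk⟩ := hS <;> fin_cases i <;> exact absurd hk ‹_›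
    · exact absurd hC hp.2

theorem finite_fiber_F (hθ : θ ∈ Ioo 0 (Real.pi / 4)) (c : ℝ × ℝ) :
    {p ∈ rect \ pieceC θ | F θ p = c}.Finite := by
  refine (finite_iUnion fun k => (subsingleton_singleton.preimage (s := {c})
    (isSpecialAffine_pieceMap hθ k).injective).finite).subset fun p hp => ?_
  obtain ⟨k, -, hk⟩ := exists_mem_piece_F_eq_pieceMap hθ hp.1
  exact mem_iUnion.2 ⟨k, hk.symm.trans hp.2⟩

theorem isPiecewiseSpecialAffineOn_F (hθ : θ ∈ Ioo 0 (Real.pi / 4)) :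
    IsPiecewiseSpecialAffineOn (F θ) (breakSet θ) (rect \ pieceC θ) := by
  intro T hT hconn
  obtain rfl | hne := T.eq_empty_or_nonempty
  · exact ⟨id, .id, eqOn_empty _ _⟩
  have huniq {p : ℝ × ℝ} (hp : p ∈ T) {k l : Fin 4 × Bool} (hk : p ∈ piece θ k)
      (hl : p ∈ piece θ l) : l = k := by
    by_contra hlk
    exact (hT hp).2 (piece_inter_piece_subset_breakSet hθ hlk ⟨hl, hk⟩)
  obtain ⟨k, hk⟩ := exists_subset_of_isPreconnected hconn hne (isClosed_piece θ)
    (fun p hp => mem_iUnion.2 ((exists_mem_piece_F_eq_pieceMap hθ (hT hp).1).imp fun _ h => h.1))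
    fun k l hkl => disjoint_left.2 fun p hp h => hkl (huniq hp h.2 h.1)
  refine ⟨pieceMap θ k, isSpecialAffine_pieceMap hθ k, fun p hp => ?_⟩
  obtain ⟨l, hl, hFl⟩ := exists_mem_piece_F_eq_pieceMap hθ (hT hp).1
  rw [hFl, huniq hp (hk hp) hl]

theorem le_one_of_lineMap_mem_rect (hθ : θ ∈ Ioo 0 (Real.pi / 4)) {i : Fin 4} {r : ℝ}
    (hr : AffineMap.lineMap (P θ i) (E i) r ∈ rect) : r ≤ 1 := by
  have ht := t_pos hθ
  have hs := ht.trans (t_lt_s hθ)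
  obtain ⟨-, h0, h1⟩ := hr
  rw [AffineMap.lineMap_apply_module] at h0 h1
  by_contra! hr
  fin_cases i <;> simp [P, E] at h0 h1 <;> nlinarith

theorem P_ne_E (hθ : θ ∈ Ioo 0 (Real.pi / 4)) (i : Fin 4) : P θ i ≠ E i := by
  have ht := t_pos hθ
  have hs := ht.trans (t_lt_s hθ)
  fin_cases i <;> simp [P, E, ht.ne', hs.ne']

theorem Z_mem_pieceC (hθ : θ ∈ Ioo 0 (Real.pi / 4)) : Z ∈ pieceC θ := by
  have hst := t_lt_s hθ
  apply mem_pieceC_of_le hθ <;> norm_num [Z] <;> linarith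

/-- An invariant circle of `F θ`: the notion of `IsRotSymmInvariantCircle` without the symmetry
under rotation. -/
structure IsInvariantCircle (θ : ℝ) (Γ : Set (ℝ × ℝ)) : Prop where
  subset_rect : Γ ⊆ rect
  invariant : F θ '' Γ = Γ
  encircles : Z ∉ Γ ∧ IsBounded (connectedComponentIn Γᶜ Z)
  circle : ∃ γ : UnitAddCircle → ℝ × ℝ, Continuous γ ∧ Injective γ ∧ range γ = Γ ∧
    ∃ g : CircleDeg1Lift, ∀ x : ℝ, F θ (γ x) = γ (g x : ℝ)

variable {Γ : Set (ℝ × ℝ)}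

theorem IsRotSymmInvariantCircle.isInvariantCircle (hΓ : IsRotSymmInvariantCircle θ Γ) :
    IsInvariantCircle θ Γ :=
  ⟨hΓ.subset_rect, hΓ.invariant, hΓ.encircles, hΓ.circle⟩

namespace IsInvariantCircle

theorem exists_isCurveLift (hΓ : IsInvariantCircle θ Γ) :
    ∃ φ g, IsCurveLift (F θ) φ g ∧ range φ = Γ := by
  obtain ⟨γ, hγ, hinj, hrange, g, hg⟩ := hΓ.circle
  exact ⟨_, g, .of_unitAddCircle hγ hinj hg,
    (QuotientAddGroup.mk_surjective.range_comp γ).trans hrange⟩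

theorem breakU_nonempty (hθ : θ ∈ Ioo 0 (Real.pi / 4)) (hΓ : IsInvariantCircle θ Γ)
    (hC : Disjoint Γ (pieceC θ)) (i : Fin 4) : (breakU θ Γ i).Nonempty := by
  set R : Set (ℝ × ℝ) := AffineMap.lineMap (P θ i) (E i) '' Ici (0 : ℝ)
  have hPR : P θ i ∈ R := ⟨0, self_mem_Ici, AffineMap.lineMap_apply_zero _ _⟩
  have hconn : IsPreconnected (pieceC θ ∪ R) :=
    (convex_convexHull ℝ _).isPreconnected.union _ (P_mem_pieceC i) hPR
      ((convex_Ici 0).affine_image _).isPreconnected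
  obtain ⟨p, hpΓ, hp | ⟨r, hr, rfl⟩⟩ := inter_nonempty_of_isPreconnected hconn
    (.inl (Z_mem_pieceC hθ)) hΓ.encircles.2
    fun h => not_isBounded_lineMap_image_Ici (P_ne_E hθ i) (h.subset subset_union_right)
  · exact absurd hp (disjoint_left.1 hC hpΓ)
  · have hseg : AffineMap.lineMap (P θ i) (E i) r ∈ segment ℝ (P θ i) (E i) := by
      rw [segment_eq_image_lineMap]
      exact mem_image_of_mem _ ⟨hr, le_one_of_lineMap_mem_rect hθ (hΓ.subset_rect hpΓ)⟩
    exact ⟨_, hpΓ, segment_subset_convexHull (by simp) (by simp) hseg,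
      segment_subset_convexHull (by simp) (by simp) hseg⟩

theorem nontrivial_inter_breakSet (hθ : θ ∈ Ioo 0 (Real.pi / 4)) (hΓ : IsInvariantCircle θ Γ)
    (hC : Disjoint Γ (pieceC θ)) : (Γ ∩ breakSet θ).Nontrivial := by
  have hsub (i : Fin 4) : breakU θ Γ i ⊆ Γ ∩ breakSet θ := fun p hp =>
    ⟨hp.1, mem_iUnion.2 ⟨i, .inl hp.2⟩⟩
  obtain ⟨u, hu⟩ := hΓ.breakU_nonempty hθ hC 0
  obtain ⟨v, hv⟩ := hΓ.breakU_nonempty hθ hC (0 + 2)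
  refine ⟨u, hsub _ hu, v, hsub _ hv, ?_⟩
  rintro rfl
  exact disjoint_left.1 (disjoint_sector_add_two hθ 0) (.inl hu.2.2) (.inl hv.2.2)

end IsInvariantCircle

end Geometry

end SquareMap

open SquareMap Function Set in
theorem proposition4p6_general (θ : ℝ) (hθ : θ ∈ Ioo 0 (Real.pi / 4)) (Γ : Set (ℝ × ℝ))
    (hΓ : IsInvariantCircle θ Γ) (hC : Disjoint Γ (pieceC θ)) :
    IsPeriodicOn (F θ) Γ ↔
      ∀ i : Fin 4,
        (∀ u ∈ breakU θ Γ i, u ∈ periodicPts (F θ)) ∧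
        (∀ v ∈ breakV θ Γ i, v ∈ periodicPts (F θ)) := by
  constructor
  · rintro ⟨q, hq, hper⟩ i
    exact ⟨fun u hu => ⟨q, hq, hper u hu.1⟩, fun v hv => ⟨q, hq, hper v hv.1⟩⟩
  · intro hbreak
    have hnt := hΓ.nontrivial_inter_breakSet hθ hC
    have hbreakSet : Γ ∩ breakSet θ ⊆ periodicPts (F θ) := by
      rintro p ⟨hpΓ, hp⟩
      obtain ⟨i, hU | hV⟩ := mem_iUnion.1 hp
      · exact (hbreak i).1 p ⟨hpΓ, hU⟩
      · exact (hbreak i).2 p ⟨hpΓ, hV⟩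
    have hsub : Γ ⊆ rect \ pieceC θ := subset_sdiff.2 ⟨hΓ.subset_rect, hC⟩
    have hfib (c : ℝ × ℝ) : {p ∈ Γ | F θ p = c}.Finite :=
      (finite_fiber_F hθ c).subset fun _ hp => ⟨hsub hp.1, hp.2⟩
    have hpiece := (isPiecewiseSpecialAffineOn_F hθ).mono hsub
    have hsurj : SurjOn (F θ) Γ Γ := hΓ.invariant.ge
    obtain ⟨φ, g, hφ, rfl⟩ := hΓ.exists_isCurveLift
    exact exists_iterate_eq_self_of_isCurveLift finrank_real_prod hφ hsurj hfib hpiece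
      hbreakSet hnt

theorem proposition4p6 (θ : ℝ) (hθ : θ ∈ Set.Ioo 0 (Real.pi / 4)) (Γ : Set (ℝ × ℝ))
    (hΓ : SquareMap.IsRotSymmInvariantCircle θ Γ) (hC : Disjoint Γ (SquareMap.pieceC θ)) :
    SquareMap.IsPeriodicOn (SquareMap.F θ) Γ ↔
      ∀ i : Fin 4,
        (∀ u ∈ SquareMap.breakU θ Γ i, u ∈ Function.periodicPts (SquareMap.F θ)) ∧
        (∀ v ∈ SquareMap.breakV θ Γ i, v ∈ Function.periodicPts (SquareMap.F θ)) :=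
  proposition4p6_general θ hθ Γ hΓ.isInvariantCircle hC
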